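/- Let $\lambda>0$ and let $g$ be a probability density on $[0,\infty)$ with distribution function $G(y)=\int_0^y g(u)\,du$. Consider the gated $M/G/\infty$ queue with Poisson arrivals of rate $\lambda$ and i.i.d. service times with density $g$: the customers admitted at an opening of the gate are served in parallel, and the length of the stage is the maximum of their service times. After a stage of length $x$, the gate opens for all the customers who arrived during the stage or, if there were none, for the next customer to arrive, who is then served alone (the waiting time until that arrival is not counted in the stage length). Thus the stage lengths $\{Y_n\}$ form a Markov chain on $[0,\infty)$ in which, given $Y_n=x$, the next stage length $Y_{n+1}$ is the maximum of $K=\max(N,1)$ independent service times with density $g$, where $N$ is Poisson with mean $\lambda x$ and independent of the service times. Suppose that $g$ has finite moments of all orders: $\int_0^\infty y^n g(y)\,dy<\infty$ for all $n\in\mathbb{N}$. Then: 1. For every $x\ge 0$, the transition law from $x$ has the density $$q(x,y)=\left(\lambda x\,e^{-\lambda x(1-G(y))}+e^{-\lambda x}\right)g(y),\qquad y\ge 0,$$ with respect to Lebesgue measure on $[0,\infty)$. 2. The chain has a unique stationary probability measure $\pi$ on $[0,\infty)$. 3. The measure $\pi$ has a nonnegative measurable density $f$ with respect to Lebesgue measure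 on $[0,\infty)$ such that, for every $y\ge 0$, the function $x\mapsto f(x)\,q(x,y)$ is integrable and $$f(y)=\int_0^\infty f(x)\,q(x,y)\,dx .$$ 4. The measure $\pi$ has finite moments of all orders: $\int_0^\infty y^n\,\pi(dy)<\infty$ for all $n\in\mathbb{N}$. -/

import Mathlib

open MeasureTheory ProbabilityTheory
open scoped NNReal ENNReal

namespace GatedQueue

/-- Lebesgue measure on the half-line `[0, ∞)`. -/
noncomputable def lebesgue : Measure ℝ≥0 :=
  Measure.comap ((↑) : ℝ≥0 → ℝ) volume

/-- The law on `[0, ∞)` of a service time with Lebesgue density `g`. -/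
noncomputable def serviceLaw (g : ℝ≥0 → ℝ≥0) : Measure ℝ≥0 :=
  lebesgue.withDensity (fun y => (g y : ℝ≥0∞))

/-- The distribution function `G(y) = P(σ ≤ y)` of a service time with density `g`. -/
noncomputable def serviceCDF (g : ℝ≥0 → ℝ≥0) (y : ℝ≥0) : ℝ :=
  (serviceLaw g).real (Set.Iic y)

/-- The transition density
`q(x, y) = (rate x exp (-rate x (1 - G(y))) + exp (-rate x)) g(y)`. -/
noncomputable def transitionDensity (rate : ℝ≥0) (g : ℝ≥0 → ℝ≥0) (x y : ℝ≥0) : ℝ :=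
  ((rate : ℝ) * x * Real.exp (-((rate : ℝ) * x * (1 - serviceCDF g y)))
    + Real.exp (-((rate : ℝ) * x))) * g y

theorem measurable_poissonMeasure : Measurable poissonMeasure := by
  refine Measure.measurable_of_measurable_coe _ fun s hs => ?_
  simp only [poissonMeasure, Measure.sum_apply _ hs, Measure.smul_apply, smul_eq_mul]
  refine Measurable.tsum fun n => Measurable.mul_const ?_ _
  fun_prop

/-- The number of Poisson arrivals (with the given rate) during a period of length `x`. -/
noncomputable def arrivalKernel (rate : ℝ≥0) : Kernel ℝ≥0 ℕ where
  toFun x := poissonMeasure (rate * x)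
  measurable' := measurable_poissonMeasure.comp (measurable_const_mul rate)

/-- The number of customers admitted at the opening of the gate that follows a stage of length
`x`: all those who arrived during the stage or, if there were none, the single customer who
arrives next. -/
noncomputable def admittedKernel (rate : ℝ≥0) : Kernel ℝ≥0 ℕ :=
  (arrivalKernel rate).map (fun n => max n 1)

/-- The time needed to serve `k` customers in parallel: the maximum of `k` independent service
times with density `g`. -/
noncomputable def parallelServiceKernel (g : ℝ≥0 → ℝ≥0) : Kernel ℕ ℝ≥0 :=
  Kernel.ofFunOfCountable fun k =>
    (Measure.pi (fun _ : Fin k => serviceLaw g)).map (fun s => Finset.univ.sup s)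

/-- The one-step transition kernel of the chain of stage lengths of the gated M/G/∞ queue:
given a stage of length `x`, the next one is the maximum of `max N 1` independent service times,
where `N` is Poisson with mean `rate * x` (idle waiting for a first arrival is not counted). -/
noncomputable def stageKernel (rate : ℝ≥0) (g : ℝ≥0 → ℝ≥0) : Kernel ℝ≥0 ℝ≥0 :=
  (parallelServiceKernel g) ∘ₖ (admittedKernel rate)

end GatedQueue

/-! Write `ν` for the service law and `s x = exp (-rate * x)` for the probability of no arrival. The
stage kernel splits as `P x = s x • ν + Q x` (`stageKernel_eq_smul_add`): with no arrival the chain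
regenerates from `ν`, and `Q` covers the rest. Since regeneration is possible from every state, the
candidate stationary measure is the occupation measure of a cycle, `μ = ∑ ν Q ^ n`.

If `μ` is finite, mass balance gives `∫ s dμ = 1`, so `μ` is invariant. Conversely, iterating the
splitting shows that an invariant probability `ρ` dominates `(∫ s dρ) • μ`; both have the same
integral of `s > 0`, so they coincide (`eq_smul_cycleMeasure`).

Finiteness, even of `∫ (1 + x) dμ`, is Foster's criterion with `W x = x ^ 2 + c`: the mean of `y ^
2` under `Q x` grows only linearly in `x` (`lintegral_cycleMeasure_lt_top`). The bound `q x y ≤ g y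
* (1 + rate * x)` and the finite mean then give a finite density, and carry each moment of `g` over
to the stationary law. -/

namespace GatedQueue

/-! ### Invariant measures of a kernel that regenerates from every state -/

section Regeneration

variable {X : Type*} [MeasurableSpace X]

/-- The law `ν Q ^ n`. -/
noncomputable def iterLaw (ν : Measure X) (Q : Kernel X X) : ℕ → Measure X
  | 0 => ν
  | n + 1 => (iterLaw ν Q n).bind Q

/-- The occupation measure `∑ n, ν Q ^ n` of one regeneration cycle. -/
noncomputable def cycleMeasure (ν : Measure X) (Q : Kernel X X) : Measure X :=
  Measure.sum (iterLaw ν Q)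

theorem cycleMeasure_eq_add_bind (ν : Measure X) (Q : Kernel X X) :
    cycleMeasure ν Q = ν + (cycleMeasure ν Q).bind Q := by
  have h : (cycleMeasure ν Q).bind Q = Measure.sum fun n => iterLaw ν Q (n + 1) :=
    Measure.bind_sum _ _ Q.aemeasurable
  rw [h]
  ext A hA
  rw [cycleMeasure, Measure.add_apply, Measure.sum_apply _ hA, Measure.sum_apply _ hA,
    tsum_eq_zero_add' ENNReal.summable, iterLaw]

/-- The drift inequality telescopes: each step of `Q` pays `∫ f` out of the remaining `∫ W`. -/
theorem sum_lintegral_iterLaw_add_le {ν : Measure X} {Q : Kernel X X} {f W : X → ℝ≥0∞}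
    (hf : Measurable f) (hW : Measurable W) (h : ∀ x, f x + ∫⁻ y, W y ∂Q x ≤ W x) (n : ℕ) :
    ∑ i ∈ Finset.range n, ∫⁻ x, f x ∂iterLaw ν Q i + ∫⁻ x, W x ∂iterLaw ν Q n
      ≤ ∫⁻ x, W x ∂ν := by
  induction n with
  | zero => simp [iterLaw]
  | succ n ih =>
    refine le_trans ?_ ih
    rw [Finset.sum_range_succ, add_assoc]
    gcongr
    rw [iterLaw, Measure.lintegral_bind Q.aemeasurable hW.aemeasurable, ← lintegral_add_left hf]
    exact lintegral_mono h

/-- Foster's criterion for the occupation measure of a cycle. -/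
theorem lintegral_cycleMeasure_le {ν : Measure X} {Q : Kernel X X} {f W : X → ℝ≥0∞}
    (hf : Measurable f) (hW : Measurable W) (h : ∀ x, f x + ∫⁻ y, W y ∂Q x ≤ W x) :
    ∫⁻ x, f x ∂cycleMeasure ν Q ≤ ∫⁻ x, W x ∂ν := by
  rw [cycleMeasure, lintegral_sum_measure]
  exact ENNReal.tsum_le_of_sum_range_le fun n =>
    le_self_add.trans (sum_lintegral_iterLaw_add_le hf hW h n)

variable {P Q : Kernel X X} {ν : Measure X} {s : X → ℝ≥0∞}

theorem bind_eq_smul_add_bind (hP : ∀ x, P x = s x • ν + Q x) (hs : Measurable s)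
    (ρ : Measure X) : ρ.bind P = (∫⁻ x, s x ∂ρ) • ν + ρ.bind Q := by
  ext A hA
  rw [Measure.bind_apply hA P.aemeasurable, Measure.add_apply,
    Measure.bind_apply hA Q.aemeasurable, Measure.smul_apply, smul_eq_mul,
    ← lintegral_mul_const _ hs, ← lintegral_add_left (hs.mul_const _)]
  simp [hP]

/-- A cycle ends exactly once: the mass of `μ` is `1 + (μ Q) univ` by the cycle identity and `∫ s dμ
+ (μ Q) univ` because `P` preserves mass. Finiteness allows the cancellation. -/
theorem lintegral_cycleMeasure_eq_one [IsMarkovKernel P] [IsProbabilityMeasure ν]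
    (hP : ∀ x, P x = s x • ν + Q x) (hs : Measurable s)
    (hfin : cycleMeasure ν Q Set.univ ≠ ∞) : ∫⁻ x, s x ∂cycleMeasure ν Q = 1 := by
  have h₁ := congrArg (fun m : Measure X => m Set.univ) (cycleMeasure_eq_add_bind ν Q)
  have h₂ := congrArg (fun m : Measure X => m Set.univ)
    (bind_eq_smul_add_bind hP hs (cycleMeasure ν Q))
  simp only [Measure.add_apply, measure_univ, Measure.smul_apply, smul_eq_mul, mul_one,
    Measure.bind_apply MeasurableSet.univ P.aemeasurable, lintegral_one] at h₁ h₂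
  have h₃ : (cycleMeasure ν Q).bind Q Set.univ ≠ ∞ :=
    ne_top_of_le_ne_top hfin (h₁ ▸ le_add_self)
  exact (ENNReal.add_left_inj h₃).1 (h₂.symm.trans h₁)

theorem invariant_cycleMeasure [IsMarkovKernel P] [IsProbabilityMeasure ν]
    (hP : ∀ x, P x = s x • ν + Q x) (hs : Measurable s)
    (hfin : cycleMeasure ν Q Set.univ ≠ ∞) : Kernel.Invariant P (cycleMeasure ν Q) := by
  rw [Kernel.Invariant, bind_eq_smul_add_bind hP hs,
    lintegral_cycleMeasure_eq_one hP hs hfin, one_smul, ← cycleMeasure_eq_add_bind]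

/-- Substituting `ρ = (∫ s dρ) • ν + ρ Q` into itself produces the partial sums of the cycle measure
plus a nonnegative remainder. -/
theorem smul_cycleMeasure_le (hP : ∀ x, P x = s x • ν + Q x) (hs : Measurable s)
    {ρ : Measure X} (hρ : Kernel.Invariant P ρ) :
    (∫⁻ x, s x ∂ρ) • cycleMeasure ν Q ≤ ρ := by
  have hρ' := hρ.def
  rw [bind_eq_smul_add_bind hP hs] at hρ'
  have key (n : ℕ) : (∫⁻ x, s x ∂ρ) • ∑ i ∈ Finset.range n, iterLaw ν Q i ≤ ρ := by
    induction n with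
    | zero => simp [Measure.zero_le]
    | succ n ih =>
      rw [Finset.sum_range_succ']
      refine Measure.le_iff.2 fun A hA => ?_
      conv_rhs => rw [← hρ']
      simp only [iterLaw, Measure.smul_apply, Measure.add_apply, Measure.finsetSum_apply,
        smul_eq_mul, Measure.bind_apply hA Q.aemeasurable]
      rw [mul_add, add_comm]
      gcongr
      rw [← lintegral_finsetSum_measure, ← smul_eq_mul, ← lintegral_smul_measure]
      exact lintegral_mono' ih le_rfl
  refine Measure.le_iff.2 fun A hA => ?_
  rw [Measure.smul_apply, smul_eq_mul, cycleMeasure, Measure.sum_apply _ hA,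
    ← ENNReal.tsum_mul_left]
  refine ENNReal.tsum_le_of_sum_range_le fun n => ?_
  simpa [Finset.mul_sum] using key n A

/-- The positive measure `ρ - μ` gives integral zero to a function that vanishes nowhere. -/
theorem eq_of_le_of_lintegral_eq {μ ρ : Measure X} [IsFiniteMeasure ρ] (hle : μ ≤ ρ)
    (hs : Measurable s) (hpos : ∀ x, s x ≠ 0) (h : ∫⁻ x, s x ∂μ = ∫⁻ x, s x ∂ρ)
    (hfin : ∫⁻ x, s x ∂ρ ≠ ∞) : μ = ρ := by
  have : IsFiniteMeasure μ := isFiniteMeasure_of_le ρ hle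
  have hsub : ρ - μ + μ = ρ := Measure.sub_add_cancel_of_le hle
  have h0 : ∫⁻ x, s x ∂(ρ - μ) = 0 := by
    have h₁ : ∫⁻ x, s x ∂(ρ - μ) + ∫⁻ x, s x ∂ρ = 0 + ∫⁻ x, s x ∂ρ := by
      conv_rhs => rw [← hsub]
      rw [lintegral_add_measure, h, zero_add]
    exact (ENNReal.add_left_inj hfin).1 h₁
  rw [lintegral_eq_zero_iff hs] at h0
  have hz : ρ - μ = 0 := by
    rw [← ae_eq_bot, ← Filter.eventually_false_iff_eq_bot]
    filter_upwards [h0] with x hx using hpos x hx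
  rw [← hsub, hz, zero_add]

theorem eq_smul_cycleMeasure [IsMarkovKernel P] [IsProbabilityMeasure ν]
    (hP : ∀ x, P x = s x • ν + Q x) (hs : Measurable s) (hpos : ∀ x, s x ≠ 0)
    (hfin : cycleMeasure ν Q Set.univ ≠ ∞) {ρ : Measure X} [IsProbabilityMeasure ρ]
    (hρ : Kernel.Invariant P ρ) : ρ = (cycleMeasure ν Q Set.univ)⁻¹ • cycleMeasure ν Q := by
  have hs1 (x : X) : s x ≤ 1 := by
    have h := congrArg (fun m : Measure X => m Set.univ) (hP x)
    simp only [measure_univ, Measure.add_apply, Measure.smul_apply, smul_eq_mul, mul_one] at h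
    exact h ▸ le_self_add
  have hsρ : ∫⁻ x, s x ∂ρ ≠ ∞ := by
    refine ne_top_of_le_ne_top ENNReal.one_ne_top ((lintegral_mono hs1).trans ?_)
    simp
  have heq : (∫⁻ x, s x ∂ρ) • cycleMeasure ν Q = ρ :=
    eq_of_le_of_lintegral_eq (smul_cycleMeasure_le hP hs hρ) hs hpos
      (by rw [lintegral_smul_measure, lintegral_cycleMeasure_eq_one hP hs hfin, smul_eq_mul,
        mul_one]) hsρ
  have hmass := congrArg (fun m : Measure X => m Set.univ) heq
  simp only [Measure.smul_apply, smul_eq_mul, measure_univ] at hmass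
  rw [← ENNReal.eq_inv_of_mul_eq_one_left hmass, heq]

end Regeneration

end GatedQueue

namespace GatedQueue

/-! ### Change of variables for absolutely continuous primitives -/

section Calculus

/-- `F` is bounded on the interval, and a `C¹` function is Lipschitz on a compact interval. -/
theorem _root_.AbsolutelyContinuousOnInterval.contDiff_comp {φ F : ℝ → ℝ} {a b : ℝ}
    (hφ : ContDiff ℝ 1 φ) (hF : AbsolutelyContinuousOnInterval F a b) :
    AbsolutelyContinuousOnInterval (φ ∘ F) a b := by
  obtain ⟨C, hC⟩ := hF.exists_bound
  obtain ⟨K, hK⟩ := (hφ.contDiffOn (s := Set.Icc (-C) C)).exists_lipschitzOnWith (by decide)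
    (convex_Icc _ _) isCompact_Icc
  have hmem (x : ℝ) (hx : x ∈ Set.uIcc a b) : F x ∈ Set.Icc (-C) C := abs_le.1 (hC x hx)
  rw [absolutelyContinuousOnInterval_iff] at hF ⊢
  intro ε hε
  -- `K + 1` rather than `K`, since the Lipschitz constant may be zero.
  obtain ⟨δ, hδ, h⟩ := hF (ε / (K + 1)) (by positivity)
  refine ⟨δ, hδ, fun E hE hlen => ?_⟩
  calc ∑ i ∈ Finset.range E.1, dist (φ (F (E.2 i).1)) (φ (F (E.2 i).2))
      ≤ ∑ i ∈ Finset.range E.1, (K + 1) * dist (F (E.2 i).1) (F (E.2 i).2) := by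
        refine Finset.sum_le_sum fun i hi => ?_
        refine (hK.dist_le_mul _ (hmem _ (hE.1 i hi).1) _ (hmem _ (hE.1 i hi).2)).trans ?_
        gcongr
        linarith
    _ = (K + 1) * ∑ i ∈ Finset.range E.1, dist (F (E.2 i).1) (F (E.2 i).2) :=
        (Finset.mul_sum _ _ _).symm
    _ < (K + 1) * (ε / (K + 1)) := by
        gcongr
        exact h E hE hlen
    _ = ε := by field

/-- The change of variables `s = ∫₀ᵗ h` for an integrable `h`. -/
theorem lintegral_Ioc_deriv_comp_integral {h φ : ℝ → ℝ} {b : ℝ} (hb : 0 ≤ b)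
    (hh : IntervalIntegrable h volume 0 b) (hh0 : ∀ t, 0 ≤ h t) (hφ : ContDiff ℝ 1 φ)
    (hφ' : ∀ t, 0 ≤ deriv φ t) :
    ∫⁻ t in Set.Ioc 0 b, ENNReal.ofReal (deriv φ (∫ u in (0 : ℝ)..t, h u) * h t) =
      ENNReal.ofReal (φ (∫ u in (0 : ℝ)..b, h u) - φ 0) := by
  -- As `h` is only integrable, the chain rule holds merely almost everywhere; absolute continuity
  -- is what still gives the fundamental theorem.
  have hac : AbsolutelyContinuousOnInterval (φ ∘ fun t => ∫ u in (0 : ℝ)..t, h u) 0 b :=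
    (hh.absolutelyContinuousOnInterval_intervalIntegral (by simp)).contDiff_comp hφ
  have hae : ∀ᵐ t ∂volume.restrict (Set.Ioc 0 b),
      deriv (φ ∘ fun t => ∫ u in (0 : ℝ)..t, h u) t =
        deriv φ (∫ u in (0 : ℝ)..t, h u) * h t := by
    filter_upwards [ae_restrict_of_ae hh.ae_hasDerivAt_integral,
      ae_restrict_mem measurableSet_Ioc] with t ht htb
    have ht' := ht (by rw [Set.uIcc_of_le hb]; exact Set.Ioc_subset_Icc_self htb) 0 (by simp)
    exact (((hφ.differentiable one_ne_zero) _).hasDerivAt.comp t ht').deriv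
  have hint := hac.intervalIntegrable_deriv
  rw [intervalIntegrable_iff_integrableOn_Ioc_of_le hb] at hint
  have heq := hac.integral_deriv_eq_sub
  rw [intervalIntegral.integral_of_le hb] at heq
  simp only [Function.comp_apply, intervalIntegral.integral_same] at heq
  rw [← heq, ofReal_integral_eq_lintegral_ofReal hint]
  · refine lintegral_congr_ae ?_
    filter_upwards [hae] with t ht
    rw [← ht, Function.comp_def]
  · filter_upwards [hae] with t ht
    exact (mul_nonneg (hφ' _) (hh0 t)).trans_eq ht.symm

end Calculus

theorem setLIntegral_lebesgue_Iic (φ : ℝ → ℝ≥0∞) (y : ℝ≥0) :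
    ∫⁻ u in Set.Iic y, φ u ∂lebesgue = ∫⁻ t in Set.Ioc (0 : ℝ) y, φ t := by
  have hemb : MeasurableEmbedding ((↑) : ℝ≥0 → ℝ) :=
    MeasurableEmbedding.subtype_coe measurableSet_Ici
  have hpre : Set.Iic y = ((↑) : ℝ≥0 → ℝ) ⁻¹' Set.Iic (y : ℝ) := by ext; simp
  have hrange : Set.range ((↑) : ℝ≥0 → ℝ) = Set.Ici 0 := Subtype.range_coe
  rw [hpre, lebesgue, ← hemb.lintegral_map, ← hemb.restrict_map, hemb.map_comap, hrange,
    Measure.restrict_restrict measurableSet_Iic, Set.Iic_inter_Ici]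
  exact setLIntegral_congr Ioc_ae_eq_Icc.symm

/-! ### The service law and its distribution function -/

section ServiceLaw

variable {g : ℝ≥0 → ℝ≥0}

theorem lintegral_serviceLaw (hg : Measurable g) (φ : ℝ≥0 → ℝ≥0∞) :
    ∫⁻ u, φ u ∂serviceLaw g = ∫⁻ u, g u * φ u ∂lebesgue :=
  lintegral_withDensity_eq_lintegral_mul_non_measurable _ hg.coe_nnreal_ennreal
    (by simp) φ

theorem isProbabilityMeasure_serviceLaw
    (hg_density : ∫⁻ y, (g y : ℝ≥0∞) ∂lebesgue = 1) : IsProbabilityMeasure (serviceLaw g) :=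
  ⟨by rw [serviceLaw, withDensity_apply _ MeasurableSet.univ, setLIntegral_univ, hg_density]⟩

theorem measurable_serviceCDF [IsProbabilityMeasure (serviceLaw g)] :
    Measurable (serviceCDF g) :=
  Monotone.measurable fun _ _ h => measureReal_mono (Set.Iic_subset_Iic.2 h)

theorem serviceCDF_nonneg (y : ℝ≥0) : 0 ≤ serviceCDF g y := measureReal_nonneg

theorem serviceCDF_le_one [IsProbabilityMeasure (serviceLaw g)] (y : ℝ≥0) :
    serviceCDF g y ≤ 1 := measureReal_le_one

theorem serviceLaw_Iic [IsProbabilityMeasure (serviceLaw g)] (y : ℝ≥0) :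
    serviceLaw g (Set.Iic y) = ENNReal.ofReal (serviceCDF g y) := by
  rw [serviceCDF, ofReal_measureReal]

theorem serviceLaw_Iic_eq_lintegral (y : ℝ≥0) :
    serviceLaw g (Set.Iic y) =
      ∫⁻ t in Set.Ioc (0 : ℝ) y, ENNReal.ofReal (g t.toNNReal : ℝ) := by
  rw [← setLIntegral_lebesgue_Iic, serviceLaw, withDensity_apply _ measurableSet_Iic]
  simp

theorem intervalIntegrable_density (hg : Measurable g) [IsProbabilityMeasure (serviceLaw g)]
    (y : ℝ≥0) : IntervalIntegrable (fun t : ℝ => (g t.toNNReal : ℝ)) volume 0 y := by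
  rw [intervalIntegrable_iff_integrableOn_Ioc_of_le y.coe_nonneg]
  refine ⟨(hg.comp measurable_real_toNNReal).coe_nnreal_real.aestronglyMeasurable, ?_⟩
  rw [hasFiniteIntegral_iff_ofReal
      (Filter.Eventually.of_forall fun t : ℝ => (g t.toNNReal).coe_nonneg),
    ← serviceLaw_Iic_eq_lintegral]
  exact measure_lt_top _ _

theorem serviceCDF_eq_integral (hg : Measurable g) (y : ℝ≥0) :
    serviceCDF g y = ∫ t in (0 : ℝ)..y, (g t.toNNReal : ℝ) := by
  rw [intervalIntegral.integral_of_le y.coe_nonneg, integral_eq_lintegral_of_nonneg_ae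
    (Filter.Eventually.of_forall fun t : ℝ => (g t.toNNReal).coe_nonneg)
    (hg.comp measurable_real_toNNReal).coe_nnreal_real.aestronglyMeasurable,
    ← serviceLaw_Iic_eq_lintegral]
  rfl

/-- Integration of `φ'(G)` against the service law. -/
theorem setLIntegral_deriv_comp_serviceCDF (hg : Measurable g)
    [IsProbabilityMeasure (serviceLaw g)] {φ : ℝ → ℝ} (hφ : ContDiff ℝ 1 φ)
    (hφ' : ∀ t, 0 ≤ deriv φ t) (y : ℝ≥0) :
    ∫⁻ u in Set.Iic y, ENNReal.ofReal (deriv φ (serviceCDF g u)) ∂serviceLaw g =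
      ENNReal.ofReal (φ (serviceCDF g y) - φ 0) := by
  rw [serviceCDF_eq_integral hg y, ← lintegral_Ioc_deriv_comp_integral y.coe_nonneg
    (intervalIntegrable_density hg y) (fun t => (g t.toNNReal).2) hφ hφ',
    ← setLIntegral_lebesgue_Iic, serviceLaw, restrict_withDensity measurableSet_Iic,
    lintegral_withDensity_eq_lintegral_mul_non_measurable _ hg.coe_nnreal_ennreal (by simp)]
  refine lintegral_congr fun u => ?_
  rw [← serviceCDF_eq_integral hg, ENNReal.ofReal_mul (hφ' _), Real.toNNReal_coe,
    ENNReal.ofReal_coe_nnreal, Pi.mul_apply, mul_comm]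

theorem setLIntegral_exp_serviceCDF (hg : Measurable g) [IsProbabilityMeasure (serviceLaw g)]
    {a : ℝ} (ha : 0 ≤ a) (y : ℝ≥0) :
    ∫⁻ u in Set.Iic y, ENNReal.ofReal (a * Real.exp (-(a * (1 - serviceCDF g u))))
        ∂serviceLaw g =
      ENNReal.ofReal (Real.exp (-(a * (1 - serviceCDF g y))) - Real.exp (-a)) := by
  have hd (t : ℝ) : deriv (fun t => Real.exp (-(a * (1 - t)))) t =
      a * Real.exp (-(a * (1 - t))) := by
    have h : HasDerivAt (fun t : ℝ => -(a * (1 - t))) a t := by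
      simpa using (((hasDerivAt_id t).const_sub 1).const_mul a).fun_neg
    rw [h.exp.deriv, mul_comm]
  have h := setLIntegral_deriv_comp_serviceCDF hg (φ := fun t => Real.exp (-(a * (1 - t))))
    (by fun_prop) (fun t => by rw [hd]; positivity) y
  simpa [hd] using h

end ServiceLaw

/-! ### Splitting and density of the stage kernel -/

section StageKernel

variable {rate : ℝ≥0} {g : ℝ≥0 → ℝ≥0}

theorem measurable_univ_sup {k : ℕ} :
    Measurable fun s : Fin k → ℝ≥0 => Finset.univ.sup s :=
  (Continuous.finset_sup_apply (s := Finset.univ) fun i _ => continuous_apply i).measurable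

theorem parallelServiceKernel_Iic [IsProbabilityMeasure (serviceLaw g)] (k : ℕ) (y : ℝ≥0) :
    parallelServiceKernel g k (Set.Iic y) = ENNReal.ofReal (serviceCDF g y ^ k) := by
  have hpre : (fun s : Fin k → ℝ≥0 => Finset.univ.sup s) ⁻¹' Set.Iic y =
      Set.univ.pi fun _ => Set.Iic y := by
    ext s; simp [Pi.le_def]
  change (Measure.map _ _) _ = _
  rw [Measure.map_apply measurable_univ_sup measurableSet_Iic, hpre, Measure.pi_pi, Finset.prod_const,
    Finset.card_fin, serviceLaw_Iic, ENNReal.ofReal_pow (serviceCDF_nonneg y)]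

theorem stageKernel_Iic [IsProbabilityMeasure (serviceLaw g)] (x y : ℝ≥0) :
    stageKernel rate g x (Set.Iic y) =
      ENNReal.ofReal (Real.exp (-(rate * x * (1 - serviceCDF g y))) - Real.exp (-(rate * x))
        + Real.exp (-(rate * x)) * serviceCDF g y) := by
  set G := serviceCDF g y with hG
  have hG0 : 0 ≤ G := serviceCDF_nonneg y
  have h₁ : HasSum (fun n : ℕ => Real.exp (-(rate * x)) * ((rate * x * G) ^ n / n.factorial))
      (Real.exp (-(rate * x)) * Real.exp (rate * x * G)) := by
    rw [Real.exp_eq_exp_ℝ]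
    exact (NormedSpace.expSeries_div_hasSum_exp (rate * x * G : ℝ)).mul_left
      (NormedSpace.exp (-(rate * x) : ℝ))
  -- Corrects the Poisson generating function at `n = 0`, where one customer is served and `G ^ 0`
  -- must become `G`.
  have h₂ : HasSum (fun n : ℕ => if n = 0 then Real.exp (-(rate * x)) * (G - 1) else 0)
      (Real.exp (-(rate * x)) * (G - 1)) := hasSum_ite_eq 0 _
  have h : HasSum (fun n : ℕ =>
      Real.exp (-(rate * x)) * (rate * x) ^ n / n.factorial * G ^ max n 1)
      (Real.exp (-(rate * x * (1 - G))) - Real.exp (-(rate * x))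
        + Real.exp (-(rate * x)) * G) := by
    convert h₁.add h₂ using 1
    · ext n
      rcases n with _ | n
      · simp; ring
      · simp [mul_pow]; ring
    · rw [← Real.exp_add]
      ring_nf
  rw [stageKernel, Kernel.comp_apply' _ _ _ measurableSet_Iic, admittedKernel,
    Kernel.lintegral_map _ (by fun_prop) _ (by fun_prop)]
  change ∫⁻ n, _ ∂poissonMeasure (rate * x) = _
  simp_rw [parallelServiceKernel_Iic]
  rw [lintegral_countable', ← h.tsum_eq, ENNReal.ofReal_tsum_of_nonneg _ h.summable]
  · refine tsum_congr fun n => ?_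
    rw [poissonMeasure_singleton, mul_comm, ← ENNReal.ofReal_mul (by positivity)]
    simp [hG]
  · intro n
    positivity

instance : IsMarkovKernel (admittedKernel rate) := by
  have : IsMarkovKernel (arrivalKernel rate) :=
    ⟨fun x => inferInstanceAs (IsProbabilityMeasure (poissonMeasure (rate * x)))⟩
  exact Kernel.IsMarkovKernel.map _ (by fun_prop)

theorem isMarkovKernel_stageKernel [IsProbabilityMeasure (serviceLaw g)] :
    IsMarkovKernel (stageKernel rate g) := by
  have : IsMarkovKernel (parallelServiceKernel g) :=
    ⟨fun k => Measure.isProbabilityMeasure_map measurable_univ_sup.aemeasurable⟩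
  exact inferInstanceAs (IsMarkovKernel (parallelServiceKernel g ∘ₖ admittedKernel rate))

/-- The transition density with respect to the service law of the stages that follow at least
one arrival. -/
noncomputable def arrivalDensity (rate : ℝ≥0) (g : ℝ≥0 → ℝ≥0) (x y : ℝ≥0) : ℝ≥0∞ :=
  ENNReal.ofReal ((rate : ℝ) * x * Real.exp (-((rate : ℝ) * x * (1 - serviceCDF g y))))

theorem measurable_arrivalDensity [IsProbabilityMeasure (serviceLaw g)] :
    Measurable (Function.uncurry (arrivalDensity rate g)) := by
  have := measurable_serviceCDF (g := g)
  unfold arrivalDensity Function.uncurry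
  fun_prop

/-- The part of the stage kernel in which at least one customer arrives during the stage. -/
noncomputable def arrivalPart (rate : ℝ≥0) (g : ℝ≥0 → ℝ≥0) [IsProbabilityMeasure (serviceLaw g)] :
    Kernel ℝ≥0 ℝ≥0 :=
  Kernel.withDensity (Kernel.const _ (serviceLaw g)) (arrivalDensity rate g)

theorem arrivalPart_apply [IsProbabilityMeasure (serviceLaw g)] (x : ℝ≥0) :
    arrivalPart rate g x = (serviceLaw g).withDensity (arrivalDensity rate g x) := by
  rw [arrivalPart, Kernel.withDensity_apply _ measurable_arrivalDensity, Kernel.const_apply]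

/-- Both sides have the same distribution function: the density of the arrival part is the
derivative of `exp (-a * (1 - t))` at `t = G`, with `a = rate * x`. -/
theorem stageKernel_eq_smul_add (hg : Measurable g) [IsProbabilityMeasure (serviceLaw g)]
    (x : ℝ≥0) : stageKernel rate g x =
      ENNReal.ofReal (Real.exp (-(rate * x))) • serviceLaw g + arrivalPart rate g x := by
  have := isMarkovKernel_stageKernel (rate := rate) (g := g)
  refine Measure.ext_of_Iic _ _ fun y => ?_
  have hle : Real.exp (-(rate * x)) ≤ Real.exp (-(rate * x * (1 - serviceCDF g y))) := by
    have h : (rate : ℝ) * x * (1 - serviceCDF g y) ≤ rate * x :=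
      mul_le_of_le_one_right (by positivity) (by linarith [serviceCDF_nonneg (g := g) y])
    gcongr
  rw [stageKernel_Iic, Measure.add_apply, Measure.smul_apply, serviceLaw_Iic, smul_eq_mul,
    arrivalPart_apply, withDensity_apply _ measurableSet_Iic]
  simp only [arrivalDensity]
  rw [setLIntegral_exp_serviceCDF hg (by positivity), ← ENNReal.ofReal_mul (by positivity),
    add_comm, ENNReal.ofReal_add (by have := serviceCDF_nonneg (g := g) y; positivity)
      (sub_nonneg.2 hle)]

theorem ofReal_transitionDensity (x y : ℝ≥0) :
    ENNReal.ofReal (transitionDensity rate g x y) =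
      g y * (ENNReal.ofReal (Real.exp (-(rate * x))) + arrivalDensity rate g x y) := by
  rw [transitionDensity, ENNReal.ofReal_mul (by positivity), ENNReal.ofReal_coe_nnreal,
    ENNReal.ofReal_add (by positivity) (by positivity), mul_comm, add_comm, arrivalDensity]

theorem stageKernel_eq_withDensity (hg : Measurable g) [IsProbabilityMeasure (serviceLaw g)]
    (x : ℝ≥0) : stageKernel rate g x =
      lebesgue.withDensity fun y => ENNReal.ofReal (transitionDensity rate g x y) := by
  rw [stageKernel_eq_smul_add hg, arrivalPart_apply]
  have hm : Measurable (arrivalDensity rate g x) := measurable_arrivalDensity.of_uncurry_left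
  rw [← withDensity_const, ← withDensity_add_left measurable_const, serviceLaw,
    ← withDensity_mul _ hg.coe_nnreal_ennreal (measurable_const.add hm)]
  congr 1
  ext y
  rw [ofReal_transitionDensity]
  rfl

end StageKernel

end GatedQueue

namespace GatedQueue

instance : SigmaFinite lebesgue :=
  ⟨⟨{ set := fun n => Set.Iic (n : ℝ≥0)
      set_mem := fun _ => trivial
      finite := fun n => by
        have h := setLIntegral_lebesgue_Iic (fun _ => 1) n
        rw [setLIntegral_one, setLIntegral_one, Real.volume_Ioc] at h
        exact h ▸ ENNReal.ofReal_lt_top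
      spanning := Set.iUnion_eq_univ_iff.2 fun x => exists_nat_ge x }⟩⟩

/-! ### Quadratic drift and finiteness of the cycle measure -/

section Drift

variable {rate : ℝ≥0} {g : ℝ≥0 → ℝ≥0}

theorem arrivalDensity_le [IsProbabilityMeasure (serviceLaw g)] (x y : ℝ≥0) :
    arrivalDensity rate g x y ≤ rate * x := by
  have h : Real.exp (-((rate : ℝ) * x * (1 - serviceCDF g y))) ≤ 1 := by
    rw [Real.exp_le_one_iff, neg_nonpos]
    have := serviceCDF_le_one (g := g) y
    exact mul_nonneg (by positivity) (by linarith)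
  rw [arrivalDensity, ← ENNReal.coe_mul, ← ENNReal.ofReal_coe_nnreal, NNReal.coe_mul]
  exact ENNReal.ofReal_le_ofReal (mul_le_of_le_one_right (by positivity) h)

theorem lintegral_arrivalPart_le [IsProbabilityMeasure (serviceLaw g)] {φ : ℝ≥0 → ℝ≥0∞}
    (hφ : Measurable φ) (x : ℝ≥0) :
    ∫⁻ y, φ y ∂arrivalPart rate g x ≤ rate * x * ∫⁻ y, φ y ∂serviceLaw g := by
  rw [arrivalPart_apply, lintegral_withDensity_eq_lintegral_mul _
    measurable_arrivalDensity.of_uncurry_left hφ, ← lintegral_const_mul _ hφ]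
  exact lintegral_mono fun y => mul_le_mul_left (arrivalDensity_le x y) _

theorem ofReal_exp_le_one (x : ℝ≥0) : ENNReal.ofReal (Real.exp (-(rate * x))) ≤ 1 := by
  rw [ENNReal.ofReal_le_one, Real.exp_le_one_iff, neg_nonpos]
  positivity

theorem lintegral_stageKernel_le (hg : Measurable g) [IsProbabilityMeasure (serviceLaw g)]
    {φ : ℝ≥0 → ℝ≥0∞} (hφ : Measurable φ) (x : ℝ≥0) :
    ∫⁻ y, φ y ∂stageKernel rate g x ≤ (1 + rate * x) * ∫⁻ y, φ y ∂serviceLaw g := by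
  rw [stageKernel_eq_smul_add hg, lintegral_add_measure, lintegral_smul_measure, smul_eq_mul,
    add_mul]
  gcongr
  · exact ofReal_exp_le_one x
  · exact lintegral_arrivalPart_le hφ x

theorem ofReal_transitionDensity_le [IsProbabilityMeasure (serviceLaw g)] (x y : ℝ≥0) :
    ENNReal.ofReal (transitionDensity rate g x y) ≤ g y * (1 + rate * x) := by
  rw [ofReal_transitionDensity]
  gcongr
  · exact ofReal_exp_le_one x
  · exact arrivalDensity_le x y

theorem exists_affine_le_sq_add_exp {r b : ℝ} (hr : 0 ≤ r) (hb : 0 ≤ b) :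
    ∃ c : ℝ, 0 ≤ c ∧ ∀ x, 0 ≤ x → 1 + b * x ≤ x ^ 2 + c * Real.exp (-(r * x)) := by
  -- Beyond `b + 1` the square alone dominates; below it, this constant makes the exponential term
  -- at least `1 + b * (b + 1)`.
  refine ⟨(1 + b * (b + 1)) * Real.exp (r * (b + 1)), by positivity, fun x hx => ?_⟩
  rcases le_total (b + 1) x with h | h
  · have : 0 ≤ (1 + b * (b + 1)) * Real.exp (r * (b + 1)) * Real.exp (-(r * x)) := by positivity
    nlinarith
  · have h₁ : 1 ≤ Real.exp (r * (b + 1)) * Real.exp (-(r * x)) := by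
      rw [← Real.exp_add, Real.one_le_exp_iff]
      nlinarith
    have h₂ : 1 + b * x ≤ 1 + b * (b + 1) := by gcongr
    have h₃ := le_mul_of_one_le_right (by positivity : 0 ≤ 1 + b * (b + 1)) h₁
    nlinarith [sq_nonneg x]

theorem exists_affine_le_sq_add_ofReal_exp (r b : ℝ≥0) :
    ∃ c : ℝ≥0, ∀ x : ℝ≥0, (1 + b * x : ℝ≥0∞) ≤
      (x : ℝ≥0∞) ^ 2 + c * ENNReal.ofReal (Real.exp (-(r * x))) := by
  obtain ⟨c, hc, h⟩ := exists_affine_le_sq_add_exp r.coe_nonneg b.coe_nonneg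
  lift c to ℝ≥0 using hc
  refine ⟨c, fun x => ?_⟩
  have := ENNReal.ofReal_le_ofReal (h x x.coe_nonneg)
  rwa [ENNReal.ofReal_add (by positivity) (by positivity),
    ENNReal.ofReal_add (by positivity) (by positivity), ENNReal.ofReal_mul (by positivity),
    ENNReal.ofReal_mul (by positivity), ENNReal.ofReal_pow (by positivity),
    ENNReal.ofReal_one, ENNReal.ofReal_coe_nnreal, ENNReal.ofReal_coe_nnreal,
    ENNReal.ofReal_coe_nnreal] at this

/-- The constant `c` in `W` is useful because `Q` loses mass: it drops by `c * s x`, which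
compensates for small `x`, where `x ^ 2` is too small. -/
theorem lintegral_cycleMeasure_lt_top (hg : Measurable g) [IsProbabilityMeasure (serviceLaw g)]
    (hm : ∫⁻ y, (y : ℝ≥0∞) ^ 2 ∂serviceLaw g < ∞) :
    ∫⁻ x, (1 + x : ℝ≥0∞) ∂cycleMeasure (serviceLaw g) (arrivalPart rate g) < ∞ := by
  have := isMarkovKernel_stageKernel (rate := rate) (g := g)
  obtain ⟨m, hm'⟩ := ENNReal.lt_iff_exists_coe.1 hm |>.imp fun _ h => h.1.symm
  -- The slope collects `x` from `f x = 1 + x` and `rate * m * x` from the second moment under `Q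
  -- x`.
  obtain ⟨c, hc⟩ := exists_affine_le_sq_add_ofReal_exp rate (1 + rate * m)
  have hsq : Measurable fun x : ℝ≥0 => (x : ℝ≥0∞) ^ 2 := by fun_prop
  refine (lintegral_cycleMeasure_le (f := fun x : ℝ≥0 => (1 + x : ℝ≥0∞))
    (W := fun x : ℝ≥0 => (x : ℝ≥0∞) ^ 2 + c) (by fun_prop) (by fun_prop) fun x => ?_).trans_lt ?_
  · have hmass : ENNReal.ofReal (Real.exp (-(rate * x))) +
        arrivalPart rate g x Set.univ = 1 := by
      have h := congrArg (fun μ : Measure ℝ≥0 => μ Set.univ)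
        (stageKernel_eq_smul_add (rate := rate) hg x)
      simpa using h.symm
    rw [lintegral_add_left hsq, lintegral_const]
    calc (1 + x : ℝ≥0∞) + (∫⁻ y, (y : ℝ≥0∞) ^ 2 ∂arrivalPart rate g x
          + c * arrivalPart rate g x Set.univ)
        ≤ (1 + x : ℝ≥0∞) + (rate * x * m + c * arrivalPart rate g x Set.univ) := by
          gcongr
          exact (lintegral_arrivalPart_le hsq x).trans_eq (by rw [hm'])
      _ = (1 + ((1 + rate * m : ℝ≥0) : ℝ≥0∞) * x) + c * arrivalPart rate g x Set.univ := by
          push_cast; ring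
      _ ≤ ((x : ℝ≥0∞) ^ 2 + c * ENNReal.ofReal (Real.exp (-(rate * x)))) +
            c * arrivalPart rate g x Set.univ := by
          gcongr ?_ + _
          exact hc x
      _ = (x : ℝ≥0∞) ^ 2 + c := by rw [add_assoc, ← mul_add, hmass, mul_one]
  · rw [lintegral_add_left hsq, lintegral_const, measure_univ, mul_one]
    exact ENNReal.add_lt_top.2 ⟨hm, ENNReal.coe_lt_top⟩

end Drift

/-! ### Density and moments of the stationary law -/

section Stationary

variable {rate : ℝ≥0} {g : ℝ≥0 → ℝ≥0}

theorem measurable_ofReal_transitionDensity (hg : Measurable g)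
    [IsProbabilityMeasure (serviceLaw g)] :
    Measurable (Function.uncurry fun x y => ENNReal.ofReal (transitionDensity rate g x y)) := by
  have := measurable_serviceCDF (g := g)
  unfold transitionDensity Function.uncurry
  fun_prop

theorem transitionDensity_nonneg (x y : ℝ≥0) : 0 ≤ transitionDensity rate g x y := by
  unfold transitionDensity
  positivity

theorem exists_density_of_invariant (hg : Measurable g) [IsProbabilityMeasure (serviceLaw g)]
    {π : Measure ℝ≥0} [IsProbabilityMeasure π] (hπ : Kernel.Invariant (stageKernel rate g) π)
    (hmean : ∫⁻ x, (1 + rate * x : ℝ≥0∞) ∂π ≠ ∞) :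
    ∃ f : ℝ≥0 → ℝ, Measurable f ∧ (∀ y, 0 ≤ f y) ∧
      π = lebesgue.withDensity (fun y => ENNReal.ofReal (f y)) ∧
      ∀ y : ℝ≥0, Integrable (fun x : ℝ≥0 => f x * transitionDensity rate g x y) lebesgue ∧
        f y = ∫ x : ℝ≥0, f x * transitionDensity rate g x y ∂lebesgue := by
  have hq := measurable_ofReal_transitionDensity (rate := rate) hg
  -- This version of the density makes the integral equation hold for every `y`, not just almost
  -- every one.
  set F : ℝ≥0 → ℝ≥0∞ := fun y => ∫⁻ x, ENNReal.ofReal (transitionDensity rate g x y) ∂π with hF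
  have hFm : Measurable F := hq.lintegral_prod_left'
  have hFtop (y : ℝ≥0) : F y ≠ ∞ := by
    refine ne_top_of_le_ne_top ?_
      (lintegral_mono fun x => ofReal_transitionDensity_le (rate := rate) (g := g) x y)
    rw [lintegral_const_mul _ (by fun_prop)]
    exact ENNReal.mul_ne_top ENNReal.coe_ne_top hmean
  have hfF (y : ℝ≥0) : ENNReal.ofReal (F y).toReal = F y := ENNReal.ofReal_toReal (hFtop y)
  have hdens : π = lebesgue.withDensity fun y => ENNReal.ofReal (F y).toReal := by
    simp_rw [hfF]
    ext A hA
    conv_lhs => rw [← hπ.def]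
    rw [Measure.bind_apply hA (Kernel.aemeasurable _), withDensity_apply _ hA,
      lintegral_lintegral_swap (f := fun y x => ENNReal.ofReal (transitionDensity rate g x y))
        (hq.comp measurable_swap).aemeasurable]
    refine lintegral_congr fun x => ?_
    rw [stageKernel_eq_withDensity hg, withDensity_apply _ hA]
  have hfm : Measurable fun y => (F y).toReal := hFm.ennreal_toReal
  refine ⟨fun y => (F y).toReal, hfm, fun y => ENNReal.toReal_nonneg, hdens, fun y => ?_⟩
  have hqy : Measurable fun x => ENNReal.ofReal (transitionDensity rate g x y) :=
    hq.of_uncurry_right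
  have hqy' : Measurable fun x => transitionDensity rate g x y := by
    convert hqy.ennreal_toReal using 2 with x
    rw [ENNReal.toReal_ofReal (transitionDensity_nonneg x y)]
  have hnonneg (x : ℝ≥0) : 0 ≤ (F x).toReal * transitionDensity rate g x y :=
    mul_nonneg ENNReal.toReal_nonneg (transitionDensity_nonneg x y)
  have hint : ∫⁻ x, ENNReal.ofReal ((F x).toReal * transitionDensity rate g x y) ∂lebesgue
      = F y := by
    conv_rhs => rw [hF, hdens]
    simp only
    rw [lintegral_withDensity_eq_lintegral_mul _ (by fun_prop) hqy]
    refine lintegral_congr fun x => ?_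
    rw [ENNReal.ofReal_mul ENNReal.toReal_nonneg, Pi.mul_apply]
  have hmeas := (hfm.mul hqy').aestronglyMeasurable (μ := lebesgue)
  refine ⟨⟨hmeas, ?_⟩, ?_⟩
  · rw [hasFiniteIntegral_iff_ofReal (Filter.Eventually.of_forall hnonneg), hint]
    exact (hFtop y).lt_top
  · rw [integral_eq_lintegral_of_nonneg_ae (Filter.Eventually.of_forall hnonneg) hmeas, hint]

/-- One step from `π` reproduces `π`, and costs at most the factor `1 + rate * x`, which is
`π`-integrable. -/
theorem lintegral_lt_top_of_invariant (hg : Measurable g) [IsProbabilityMeasure (serviceLaw g)]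
    {π : Measure ℝ≥0} (hπ : Kernel.Invariant (stageKernel rate g) π)
    (hmean : ∫⁻ x, (1 + rate * x : ℝ≥0∞) ∂π ≠ ∞) {φ : ℝ≥0 → ℝ≥0∞} (hφ : Measurable φ)
    (hfin : ∫⁻ y, φ y ∂serviceLaw g < ∞) : ∫⁻ y, φ y ∂π < ∞ := by
  rw [← hπ.def, Measure.lintegral_bind (Kernel.aemeasurable _) hφ.aemeasurable]
  refine (lintegral_mono fun x => lintegral_stageKernel_le hg hφ x).trans_lt ?_
  rw [lintegral_mul_const _ (by fun_prop)]
  exact ENNReal.mul_lt_top hmean.lt_top hfin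

end Stationary

end GatedQueue

theorem mainTheorem1 (rate : ℝ≥0) (hrate : 0 < rate)
    (g : ℝ≥0 → ℝ≥0) (hg : Measurable g)
    (hg_density : ∫⁻ y, (g y : ℝ≥0∞) ∂GatedQueue.lebesgue = 1)
    (hg_moments : ∀ n : ℕ, ∫⁻ y, (y : ℝ≥0∞) ^ n * (g y : ℝ≥0∞) ∂GatedQueue.lebesgue < ∞) :
    (∀ x : ℝ≥0, GatedQueue.stageKernel rate g x =
      GatedQueue.lebesgue.withDensity
        (fun y => ENNReal.ofReal (GatedQueue.transitionDensity rate g x y))) ∧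
    ∃ π : Measure ℝ≥0,
      (IsProbabilityMeasure π ∧ Kernel.Invariant (GatedQueue.stageKernel rate g) π) ∧
      (∀ ρ : Measure ℝ≥0, IsProbabilityMeasure ρ →
        Kernel.Invariant (GatedQueue.stageKernel rate g) ρ → ρ = π) ∧
      (∃ f : ℝ≥0 → ℝ, Measurable f ∧ (∀ y, 0 ≤ f y) ∧
        π = GatedQueue.lebesgue.withDensity (fun y => ENNReal.ofReal (f y)) ∧
        ∀ y : ℝ≥0,
          Integrable (fun x : ℝ≥0 => f x * GatedQueue.transitionDensity rate g x y)
            GatedQueue.lebesgue ∧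
          f y = ∫ x : ℝ≥0, f x * GatedQueue.transitionDensity rate g x y ∂GatedQueue.lebesgue) ∧
      ∀ n : ℕ, ∫⁻ y, (y : ℝ≥0∞) ^ n ∂π < ∞ := by
  have := GatedQueue.isProbabilityMeasure_serviceLaw hg_density
  have := GatedQueue.isMarkovKernel_stageKernel (rate := rate) (g := g)
  have hm (n : ℕ) : ∫⁻ y, (y : ℝ≥0∞) ^ n ∂GatedQueue.serviceLaw g < ∞ := by
    simpa only [GatedQueue.lintegral_serviceLaw hg, mul_comm] using hg_moments n
  refine ⟨GatedQueue.stageKernel_eq_withDensity hg, ?_⟩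
  set μ := GatedQueue.cycleMeasure (GatedQueue.serviceLaw g) (GatedQueue.arrivalPart rate g)
    with hμ
  have hP := GatedQueue.stageKernel_eq_smul_add (rate := rate) hg
  have hs : Measurable fun x : ℝ≥0 => ENNReal.ofReal (Real.exp (-(rate * x))) := by fun_prop
  have hpos (x : ℝ≥0) : ENNReal.ofReal (Real.exp (-(rate * x))) ≠ 0 :=
    (ENNReal.ofReal_pos.2 (Real.exp_pos _)).ne'
  have hmean : ∫⁻ x, (1 + x : ℝ≥0∞) ∂μ < ∞ :=
    GatedQueue.lintegral_cycleMeasure_lt_top hg (hm 2)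
  have hfin : μ Set.univ ≠ ∞ := by
    rw [← lintegral_one]
    exact ((lintegral_mono fun x => le_self_add).trans_lt hmean).ne
  have h0 : μ Set.univ ≠ 0 := by
    intro h
    have h1 := GatedQueue.lintegral_cycleMeasure_eq_one hP hs hfin
    rw [← hμ, Measure.measure_univ_eq_zero.1 h, lintegral_zero_measure] at h1
    exact zero_ne_one h1
  have hπ1 : IsProbabilityMeasure ((μ Set.univ)⁻¹ • μ) :=
    ⟨by rw [Measure.smul_apply, smul_eq_mul, ENNReal.inv_mul_cancel h0 hfin]⟩
  have hπ : Kernel.Invariant (GatedQueue.stageKernel rate g) ((μ Set.univ)⁻¹ • μ) := by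
    rw [Kernel.Invariant, Measure.bind_smul,
      (GatedQueue.invariant_cycleMeasure hP hs hfin).def]
  have hπmean : ∫⁻ x, (1 + rate * x : ℝ≥0∞) ∂((μ Set.univ)⁻¹ • μ) ≠ ∞ := by
    rw [lintegral_smul_measure]
    refine ENNReal.mul_ne_top (ENNReal.inv_ne_top.2 h0) ?_
    have hle (x : ℝ≥0) : (1 + rate * x : ℝ≥0∞) ≤ (1 + rate) * (1 + x) := by
      rw [add_mul, one_mul]
      gcongr
      · exact le_self_add
      · exact le_add_self
    refine ne_top_of_le_ne_top ?_ (lintegral_mono hle)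
    rw [lintegral_const_mul _ (by fun_prop)]
    exact ENNReal.mul_ne_top (by finiteness) hmean.ne
  exact ⟨(μ Set.univ)⁻¹ • μ, ⟨hπ1, hπ⟩,
    fun ρ _ hρ => GatedQueue.eq_smul_cycleMeasure hP hs hpos hfin hρ,
    GatedQueue.exists_density_of_invariant hg hπ hπmean,
    fun n => GatedQueue.lintegral_lt_top_of_invariant hg hπ hπmean (by fun_prop) (hm n)⟩
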